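/- Let $I=[0,1]$. For a topological space $X$ whose integral singular homology is finitely generated let $\chi(X)=\sum_k(-1)^k\operatorname{rank}H_k(X;\mathbb Z)$, and put $\chi(X)=\infty$ otherwise. For a map $f:I\to\mathbb R^d$, a unit vector $v\in S^{d-1}$ and $t\in\mathbb R$ let $$\mathrm{ECT}_f(v,t)=\chi\big(\{x\in I:\langle f(x),v\rangle\le t\}\big)\in\mathbb Z\cup\{\infty\},$$ and take differences pointwise, with $\infty-n=n-\infty=\infty-\infty=\infty$. For functions $F:S^{d-1}\times\mathbb R\to\mathbb Z\cup\{\infty\}$ let $$\|F\|=\sup_{v\in S^{d-1}}\int_{-a}^{a}|F(v,t)|\,\mathrm dt,$$ where $a$ is a fixed real number bounding the Euclidean norms of all points on the curves considered. A map $\gamma:I\to\mathbb R^d$ is called piecewise $C^1$ if it is continuous and $I$ is covered by finitely many closed intervals on the interiors of which $\gamma$ is $C^1$. Let $L,\varepsilon\in\mathbb R$. Let $\alpha:I\to\mathbb R^d$ be piecewise $C^1$ with $\|\alpha(0)-\alpha(1)\|=L$ and arc length at most $L+\varepsilon$. Let $\beta:I\to\mathbb R^d$ be piecewise $C^1$ with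 arc length at most $L+2\varepsilon$, $\|\alpha(0)-\beta(0)\|\le\varepsilon$ and $\|\alpha(1)-\beta(1)\|\le\varepsilon$. Suppose $\|\alpha(x)\|\le a$ and $\|\beta(x)\|\le a$ for all $x\in I$. Then for every $v\in S^{d-1}$ the function $t\mapsto|\mathrm{ECT}_\alpha(v,t)-\mathrm{ECT}_\beta(v,t)|$ is Lebesgue measurable, and $$\|\mathrm{ECT}_\alpha-\mathrm{ECT}_\beta\|\le\begin{cases}8\sqrt{L\varepsilon}&\text{if }L>2\varepsilon,\\ 10\,\varepsilon&\text{if }L\le2\varepsilon.\end{cases}$$ -/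

import Mathlib

/-- The `k`-th singular homology group `H_k(X; ℤ)` of a topological space `X`. -/
noncomputable abbrev singularHomologyGroup (X : Type) [TopologicalSpace X] (k : ℕ) :
    ModuleCat.{0} ℤ :=
  ((AlgebraicTopology.singularHomologyFunctor (ModuleCat.{0} ℤ) k).obj (ModuleCat.of ℤ ℤ)).obj
    (TopCat.of X)

/-- `X` has finitely generated (total, integral, singular) homology: every `H_k(X; ℤ)` is finitely
generated, and all but finitely many of them vanish. -/
def HasFGHomology (X : Type) [TopologicalSpace X] : Prop :=
  (∀ k : ℕ, Module.Finite ℤ (singularHomologyGroup X k)) ∧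
    ∃ N : ℕ, ∀ k : ℕ, N ≤ k → Subsingleton (singularHomologyGroup X k)

open Classical in
/-- The Euler characteristic `χ(X) = ∑ₖ (-1)ᵏ rank H_k(X; ℤ)` of a space with finitely generated
homology (the sum has only finitely many non-zero terms), with the convention that the value
is `∞ = ⊤` when the homology of `X` is not finitely generated. -/
noncomputable def eulerCharacteristic (X : Type) [TopologicalSpace X] : WithTop ℤ :=
  if HasFGHomology X then
    ((∑ᶠ k : ℕ, (-1 : ℤ) ^ k * (Module.finrank ℤ (singularHomologyGroup X k) : ℤ) : ℤ) : WithTop ℤ)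
  else ⊤

/-- The Euler characteristic transform of a map `f : Z → ℝᵈ`, sending a unit vector `v` and a real
number `t` to `χ(f⁻¹ {x | ⟨x, v⟩ ≤ t})`. -/
noncomputable def ect {Z : Type} [TopologicalSpace Z] {d : ℕ} (f : Z → EuclideanSpace ℝ (Fin d)) :
    Metric.sphere (0 : EuclideanSpace ℝ (Fin d)) 1 → ℝ → WithTop ℤ :=
  fun v t => eulerCharacteristic {z : Z // inner ℝ (f z) (v : EuclideanSpace ℝ (Fin d)) ≤ t}

/-- Absolute value on `ℤ ∪ {∞}`, with values in `[0, ∞]`. -/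
noncomputable def extAbs : WithTop ℤ → ENNReal
  | none => ⊤
  | some n => ENNReal.ofReal |(n : ℝ)|

/-- The norm `sup_v ∫_{-a}^{a} |F(v, t)| dt` of a function `F : S^{d-1} × ℝ → ℤ ∪ {∞}`.
Differences of such functions are taken pointwise, with `∞ - n = n - ∞ = ∞ - ∞ = ∞`, which is
Mathlib's subtraction on `WithTop ℤ`. -/
noncomputable def ectNorm {d : ℕ} (a : ℝ)
    (F : Metric.sphere (0 : EuclideanSpace ℝ (Fin d)) 1 → ℝ → WithTop ℤ) : ENNReal :=
  ⨆ v, ∫⁻ t in Set.Icc (-a) a, extAbs (F v t)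

/-- A map `γ : [0,1] → ℝᵈ` is piecewise `C¹` if it is continuous and `[0,1]` is covered by finitely
many closed intervals on the interiors of which `γ` is `C¹`. (Only the values of `γ` at points of
the open intervals `(l i, u i) ⊆ [0,1]` enter the differentiability condition.) -/
def IsPiecewiseC1 {d : ℕ} (γ : unitInterval → EuclideanSpace ℝ (Fin d)) : Prop :=
  Continuous γ ∧ ∃ (k : ℕ) (l u : Fin k → unitInterval),
    (∀ x : unitInterval, ∃ i, x ∈ Set.Icc (l i) (u i)) ∧
    ∀ i, ContDiffOn ℝ 1 (Set.IccExtend (zero_le_one' ℝ) γ) (Set.Ioo (l i : ℝ) (u i : ℝ))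

/-- The arc length of a path: the supremum of the lengths of its inscribed polygons. -/
noncomputable def arcLength {d : ℕ} (γ : unitInterval → EuclideanSpace ℝ (Fin d)) : ENNReal :=
  eVariationOn γ Set.univ

/-!
Fix a direction `v` and let `G` be the height of a path in that direction. A subset of the line with
finitely many components is homotopy equivalent to the discrete space of its components, so the
Euler characteristic of `{G ≤ t}` is its number of components `c(t)` whenever this is finite
(`eulerCharacteristic_eq_natCard_of_homotopyEquiv`, `homotopyEquivConnectedComponents`).

The set `{G ≤ t}` has at least `k + 1` components iff `G` oscillates `k` times across `t`
(`oscillates_iff_le_card`). Except for countably many `t` the oscillation can be made strict, and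
strict oscillation is an open condition on `t`; this makes `c` almost everywhere measurable. A strict
oscillation is also seen by every sufficiently fine grid, so `c(t)` is at most the number of downward
crossings of `t` along such a grid, plus one if `G 0 ≤ t`. By Fatou's lemma the integral of the
number of downward crossings is bounded by the negative variation of `G` along grids.

If `G 1 < G 0`, the levels `t` between these values force one downward crossing. Discounting it, one
gets `c = [min (G 0) (G 1) ≤ t] + E` with `0 ≤ E` and `∫ E` at most the negative variation of `G` minus
the forced amount `max (G 0 - G 1) 0`. For a path of length at most `ℓ` whose endpoints have distance
`D`, this excess is at most `√(ℓ² - D²) / 2` (`sum_backward_le`): reflecting the backward steps of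
an inscribed polygon in the hyperplane orthogonal to `v` preserves the length of the polygon but moves
its endpoint by twice the backward displacement.

For two paths with `ε`-close endpoints the terms `[min (G 0) (G 1) ≤ t]` differ by at most `ε` in the
integral (`lintegral_extAbs_ect_sub_ect_le`). With `ℓ = L + ε`, `D = L` for one path and
`ℓ = L + 2ε`, `D ≥ L - 2ε` for the other, both bounds follow by elementary estimates.
-/

/-! ### Singular homology of spaces equivalent to a totally disconnected space -/

open CategoryTheory AlgebraicTopology in
theorem singularHomologyGroup_map_eq_of_homotopic {X Y : TopCat.{0}} {f g : X ⟶ Y}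
    (h : f.hom.Homotopic g.hom) (k : ℕ) :
    ((singularHomologyFunctor (ModuleCat.{0} ℤ) k).obj (ModuleCat.of ℤ ℤ)).map f =
      ((singularHomologyFunctor (ModuleCat.{0} ℤ) k).obj (ModuleCat.of ℤ ℤ)).map g :=
  TopCat.Homotopy.congr_homologyMap_singularChainComplexFunctor
    (C := ModuleCat.{0} ℤ) (f := f) (g := g) h.some (ModuleCat.of ℤ ℤ) k

open CategoryTheory AlgebraicTopology in
/-- Singular homology is a homotopy invariant. -/
noncomputable def singularHomologyGroupIsoOfHomotopyEquiv {X Y : Type} [TopologicalSpace X]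
    [TopologicalSpace Y] (e : ContinuousMap.HomotopyEquiv X Y) (k : ℕ) :
    singularHomologyGroup X k ≅ singularHomologyGroup Y k where
  hom := ((singularHomologyFunctor (ModuleCat.{0} ℤ) k).obj (ModuleCat.of ℤ ℤ)).map
    (TopCat.ofHom e.toFun)
  inv := ((singularHomologyFunctor (ModuleCat.{0} ℤ) k).obj (ModuleCat.of ℤ ℤ)).map
    (TopCat.ofHom e.invFun)
  hom_inv_id := by
    rw [← Functor.map_comp, ← CategoryTheory.Functor.map_id]
    exact singularHomologyGroup_map_eq_of_homotopic e.left_inv k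
  inv_hom_id := by
    rw [← Functor.map_comp, ← CategoryTheory.Functor.map_id]
    exact singularHomologyGroup_map_eq_of_homotopic e.right_inv k

theorem subsingleton_singularHomologyGroup_of_totallyDisconnectedSpace (T : Type)
    [TopologicalSpace T] [TotallyDisconnectedSpace T] {k : ℕ} (hk : k ≠ 0) :
    Subsingleton (singularHomologyGroup T k) :=
  have : TotallyDisconnectedSpace (TopCat.of T) := ‹TotallyDisconnectedSpace T›
  ModuleCat.subsingleton_of_isZero
    (AlgebraicTopology.isZero_singularHomologyFunctor_of_totallyDisconnectedSpace
      (ModuleCat.{0} ℤ) k (ModuleCat.of ℤ ℤ) (TopCat.of T) hk)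

open CategoryTheory Limits Classical in
/-- `H₀(T; ℤ)` of a totally disconnected space `T` is free on the points of `T`. -/
noncomputable def singularHomologyGroupZeroEquiv (T : Type) [TopologicalSpace T]
    [TotallyDisconnectedSpace T] :
    singularHomologyGroup T 0 ≃ₗ[ℤ] (T →₀ ℤ) :=
  have : TotallyDisconnectedSpace (TopCat.of T) := ‹TotallyDisconnectedSpace T›
  (AlgebraicTopology.singularHomologyFunctorZeroOfTotallyDisconnectedSpace
    (ModuleCat.{0} ℤ) (ModuleCat.of ℤ ℤ) (TopCat.of T)).toLinearEquiv ≪≫ₗ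
  (colimit.isoColimitCocone ⟨_, ModuleCat.coproductCoconeIsColimit
      (fun _ : T => ModuleCat.of ℤ ℤ)⟩).toLinearEquiv ≪≫ₗ
    (finsuppLequivDFinsupp ℤ).symm

/-- A space homotopy equivalent to a finite totally disconnected space `T` has finitely generated
homology, and its Euler characteristic is the number of points of `T`. -/
theorem eulerCharacteristic_eq_natCard_of_homotopyEquiv {X T : Type} [TopologicalSpace X]
    [TopologicalSpace T] [TotallyDisconnectedSpace T] [Finite T]
    (e : ContinuousMap.HomotopyEquiv X T) :
    eulerCharacteristic X = ((Nat.card T : ℤ) : WithTop ℤ) := by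
  have hpos (k : ℕ) (hk : k ≠ 0) : Subsingleton (singularHomologyGroup X k) :=
    have := subsingleton_singularHomologyGroup_of_totallyDisconnectedSpace T hk
    (singularHomologyGroupIsoOfHomotopyEquiv e k).toLinearEquiv.toEquiv.subsingleton
  let e₀ : singularHomologyGroup X 0 ≃ₗ[ℤ] (T →₀ ℤ) :=
    (singularHomologyGroupIsoOfHomotopyEquiv e 0).toLinearEquiv ≪≫ₗ
      singularHomologyGroupZeroEquiv T
  have hfg : HasFGHomology X := by
    refine ⟨fun k => ?_, 1, fun k hk => hpos k (by omega)⟩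
    rcases eq_or_ne k 0 with rfl | hk
    · exact Module.Finite.equiv e₀.symm
    · have := hpos k hk
      infer_instance
  rw [eulerCharacteristic, if_pos hfg, finsum_eq_single _ 0]
  · have := Fintype.ofFinite T
    simp [e₀.finrank_eq]
  · intro k hk
    have := hpos k hk
    simp [Module.finrank_zero_of_subsingleton]

/-! ### Components of sets of real numbers -/

/-- In a set `A` of reals, the segment between two points of one component of `A` lies in `A`. -/
theorem uIcc_subset_of_mem_connectedComponent {A : Set ℝ} {x y : A}
    (h : y ∈ connectedComponent x) : Set.uIcc (x : ℝ) y ⊆ A := by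
  have hc : (Subtype.val '' connectedComponent x : Set ℝ).OrdConnected :=
    (isPreconnected_connectedComponent.image _ continuous_subtype_val.continuousOn).ordConnected
  refine (hc.uIcc_subset ⟨x, mem_connectedComponent, rfl⟩ ⟨y, h, rfl⟩).trans ?_
  rintro _ ⟨z, -, rfl⟩
  exact z.2

theorem mem_connectedComponent_of_uIcc_subset {A : Set ℝ} {x y : A}
    (h : Set.uIcc (x : ℝ) y ⊆ A) : y ∈ connectedComponent x := by
  have hp : IsPreconnected ((↑) ⁻¹' Set.uIcc (x : ℝ) y : Set A) := by
    rw [Topology.IsInducing.subtypeVal.isPreconnected_image.symm, Subtype.image_preimage_coe,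
      Set.inter_eq_right.2 h]
    exact isPreconnected_uIcc
  exact hp.subset_connectedComponent (Set.left_mem_uIcc) (Set.right_mem_uIcc)

instance discreteTopology_connectedComponents_of_finite (X : Type*) [TopologicalSpace X]
    [Finite (ConnectedComponents X)] : DiscreteTopology (ConnectedComponents X) := by
  have : T1Space (ConnectedComponents X) := by
    refine ⟨fun c => ?_⟩
    obtain ⟨x, rfl⟩ := ConnectedComponents.surjective_coe c
    rw [← ConnectedComponents.isQuotientMap_coe.isClosed_preimage,
      connectedComponents_preimage_singleton]
    exact isClosed_connectedComponent
  infer_instance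

/-- A set of reals with finitely many components is homotopy equivalent to the discrete space of its
components: slide every point linearly to a chosen point of its component. -/
noncomputable def homotopyEquivConnectedComponents (A : Set ℝ) [Finite (ConnectedComponents A)] :
    ContinuousMap.HomotopyEquiv A (ConnectedComponents A) where
  toFun := ⟨ConnectedComponents.mk, ConnectedComponents.continuous_coe⟩
  invFun := ⟨Function.surjInv ConnectedComponents.surjective_coe, continuous_of_discreteTopology⟩
  left_inv := by
    set r : C(A, A) := (⟨Function.surjInv ConnectedComponents.surjective_coe,
      continuous_of_discreteTopology⟩ : C(ConnectedComponents A, A)).comp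
        ⟨ConnectedComponents.mk, ConnectedComponents.continuous_coe⟩ with hr
    have hmem (s : unitInterval) (x : A) :
        (1 - (s : ℝ)) * (r x : ℝ) + (s : ℝ) * (x : ℝ) ∈ A := by
      have hx : x ∈ connectedComponent (r x) := by
        rw [← ConnectedComponents.coe_eq_coe']
        exact (Function.surjInv_eq ConnectedComponents.surjective_coe _).symm
      refine uIcc_subset_of_mem_connectedComponent hx ?_
      rw [← segment_eq_uIcc]
      exact ⟨1 - s, s, by linarith [s.2.2], s.2.1, by ring, rfl⟩
    exact ⟨{
      toFun := fun p => ⟨_, hmem p.1 p.2⟩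
      continuous_toFun := by fun_prop
      map_zero_left := fun x => by simp
      map_one_left := fun x => by simp }⟩
  right_inv := by
    convert ContinuousMap.Homotopic.refl _
    ext c
    exact (Function.surjInv_eq ConnectedComponents.surjective_coe c).symm

/-! ### Components of sublevel sets and oscillations -/

/-- The part of the sublevel set `{G ≤ t}` lying over the unit interval. -/
def unitSublevel (G : ℝ → ℝ) (t : ℝ) : Set ℝ := {x | x ∈ Set.Icc (0 : ℝ) 1 ∧ G x ≤ t}

/-- `G` oscillates `k` times across `t`: there are `x₀ < y₀ < x₁ < ⋯ < y_{k-1} < x_k` in `[0, 1]`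
with `G (x i) ≤ t < G (y i)`. Only the values `x i` with `i ≤ k` and `y i` with `i < k` matter. -/
def Oscillates (G : ℝ → ℝ) (k : ℕ) (t : ℝ) : Prop :=
  ∃ x y : ℕ → ℝ, (∀ i ≤ k, x i ∈ Set.Icc (0 : ℝ) 1 ∧ G (x i) ≤ t) ∧
    ∀ i < k, x i < y i ∧ y i < x (i + 1) ∧ t < G (y i)

/-- The variant of `Oscillates` with both inequalities strict. It is an open condition on `t`. -/
def StrictlyOscillates (G : ℝ → ℝ) (k : ℕ) (t : ℝ) : Prop :=
  ∃ x y : ℕ → ℝ, (∀ i ≤ k, x i ∈ Set.Icc (0 : ℝ) 1 ∧ G (x i) < t) ∧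
    ∀ i < k, x i < y i ∧ y i < x (i + 1) ∧ t < G (y i)

/-- The points `x i` of an oscillation lie in distinct components, being separated by the `y i`. -/
theorem Oscillates.le_card {G : ℝ → ℝ} {k : ℕ} {t : ℝ} (h : Oscillates G k t) :
    ((k + 1 : ℕ) : ℕ∞) ≤ ENat.card (ConnectedComponents (unitSublevel G t)) := by
  obtain ⟨x, y, hx, hy⟩ := h
  have hmono : ∀ j, ∀ i < j, j ≤ k → x i < y i ∧ y i < x j := by
    intro j
    induction j with
    | zero => intro i hi; omega
    | succ j ih =>
      intro i hi hj
      obtain ⟨h1, h2, -⟩ := hy j hj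
      rcases (Nat.lt_succ_iff.1 hi).eq_or_lt with rfl | hij
      · exact ⟨h1, h2⟩
      · obtain ⟨h3, h4⟩ := ih i hij (by omega)
        exact ⟨h3, by linarith⟩
  let f : Fin (k + 1) → ConnectedComponents (unitSublevel G t) :=
    fun i => ConnectedComponents.mk ⟨x i, hx i (by omega)⟩
  have key : ∀ i j : Fin (k + 1), i < j → f i ≠ f j := by
    intro i j hij he
    obtain ⟨h1, h2⟩ := hmono j i hij (by omega)
    have hm := uIcc_subset_of_mem_connectedComponent (ConnectedComponents.coe_eq_coe'.1 he.symm)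
    have : y i ∈ unitSublevel G t := hm (by rw [Set.mem_uIcc]; left; exact ⟨h1.le, h2.le⟩)
    exact absurd this.2 (not_le.2 (hy i (by omega)).2.2)
  have hf : Function.Injective f := by
    intro i j he
    rcases lt_trichotomy i j with hij | hij | hij
    · exact absurd he (key i j hij)
    · exact hij
    · exact absurd he.symm (key j i hij)
  simpa using ENat.card_le_card_of_injective hf

/-- Sorted representatives of distinct components are separated by points outside the set. -/
theorem oscillates_of_le_card {G : ℝ → ℝ} {k : ℕ} {t : ℝ}
    (h : ((k + 1 : ℕ) : ℕ∞) ≤ ENat.card (ConnectedComponents (unitSublevel G t))) :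
    Oscillates G k t := by
  obtain ⟨s, hs⟩ : ∃ s : Finset (ConnectedComponents (unitSublevel G t)), s.card = k + 1 := by
    rcases finite_or_infinite (ConnectedComponents (unitSublevel G t)) with hfin | hinf
    · have := Fintype.ofFinite (ConnectedComponents (unitSublevel G t))
      rw [ENat.card_eq_coe_fintype_card, Nat.cast_le] at h
      obtain ⟨s, -, hs⟩ := Finset.exists_subset_card_eq (s := Finset.univ) h
      exact ⟨s, hs⟩
    · exact Infinite.exists_subset_card_eq _ _
  let r := Function.surjInv (ConnectedComponents.surjective_coe (α := unitSublevel G t))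
  have hr : Function.Injective r := Function.injective_surjInv _
  have hrc : ∀ c, ConnectedComponents.mk (r c) = c := Function.surjInv_eq _
  let s' : Finset (unitSublevel G t) := s.map ⟨r, hr⟩
  have hs' : s'.card = k + 1 := by simp [s', hs]
  let e := s'.orderEmbOfFin hs'
  have he : ∀ i j : Fin (k + 1), i < j → ∃ z, (e i : ℝ) < z ∧ z < e j ∧ t < G z := by
    intro i j hij
    by_contra! hcon
    have hle : (e i : ℝ) ≤ e j := (e.monotone hij.le : e i ≤ e j)
    have hcomp : e j ∈ connectedComponent (e i) := by
      refine mem_connectedComponent_of_uIcc_subset fun z hz => ?_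
      rw [Set.uIcc_of_le hle] at hz
      rcases hz.1.eq_or_lt with hzi | hzi
      · exact hzi ▸ (e i).2
      rcases hz.2.eq_or_lt with hzj | hzj
      · exact hzj ▸ (e j).2
      exact ⟨⟨(e i).2.1.1.trans hz.1, hz.2.trans (e j).2.1.2⟩, hcon z hzi hzj⟩
    obtain ⟨ci, -, hci⟩ := Finset.mem_map.1 (s'.orderEmbOfFin_mem hs' i)
    obtain ⟨cj, -, hcj⟩ := Finset.mem_map.1 (s'.orderEmbOfFin_mem hs' j)
    change r ci = e i at hci
    change r cj = e j at hcj
    rw [← ConnectedComponents.coe_eq_coe', ← hci, ← hcj, hrc, hrc] at hcomp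
    rw [hcomp, hci] at hcj
    exact hij.ne (e.injective hcj)
  choose! z hz using he
  -- `Fin.ofNat` extends the finite families to `ℕ`; only the indices up to `k` are used.
  refine ⟨fun i => e (Fin.ofNat (k + 1) i),
    fun i => z (Fin.ofNat (k + 1) i) (Fin.ofNat (k + 1) (i + 1)), fun i _ => (e _).2, fun i hi => ?_⟩
  refine hz _ _ ?_
  rw [Fin.lt_def]
  simp only [Fin.ofNat, Nat.mod_eq_of_lt (show i < k + 1 by omega),
    Nat.mod_eq_of_lt (show i + 1 < k + 1 by omega)]
  omega

/-- The sublevel set has at least `k + 1` components iff `G` oscillates `k` times across `t`. -/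
theorem oscillates_iff_le_card {G : ℝ → ℝ} {k : ℕ} {t : ℝ} :
    Oscillates G k t ↔
      ((k + 1 : ℕ) : ℕ∞) ≤ ENat.card (ConnectedComponents (unitSublevel G t)) :=
  ⟨Oscillates.le_card, oscillates_of_le_card⟩

theorem isOpen_setOf_strictlyOscillates (G : ℝ → ℝ) (k : ℕ) :
    IsOpen {t | StrictlyOscillates G k t} := by
  simp only [StrictlyOscillates, Set.ofPred_exists]
  refine isOpen_iUnion fun x => isOpen_iUnion fun y => IsOpen.and ?_ ?_
  · have : {t | ∀ i ≤ k, x i ∈ Set.Icc (0 : ℝ) 1 ∧ G (x i) < t} =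
        ⋂ i ∈ Set.Iic k, {t | x i ∈ Set.Icc (0 : ℝ) 1 ∧ G (x i) < t} := by ext; simp
    rw [this]
    exact (Set.finite_Iic k).isOpen_biInter fun i _ => isOpen_const.and isOpen_Ioi
  · have : {t | ∀ i < k, x i < y i ∧ y i < x (i + 1) ∧ t < G (y i)} =
        ⋂ i ∈ Set.Iio k, {t | x i < y i ∧ y i < x (i + 1) ∧ t < G (y i)} := by ext; simp
    rw [this]
    exact (Set.finite_Iio k).isOpen_biInter fun i _ =>
      isOpen_const.and (isOpen_const.and isOpen_Iio)

theorem StrictlyOscillates.oscillates {G : ℝ → ℝ} {k : ℕ} {t : ℝ}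
    (h : StrictlyOscillates G k t) : Oscillates G k t := by
  obtain ⟨x, y, hx, hy⟩ := h
  exact ⟨x, y, fun i hi => ⟨(hx i hi).1, (hx i hi).2.le⟩, hy⟩

/-- Increasing `t` slightly makes the inequalities `G (x i) ≤ t` strict and keeps `t < G (y i)`. -/
theorem Oscillates.exists_Ioo_strictlyOscillates {G : ℝ → ℝ} {k : ℕ} {t : ℝ}
    (h : Oscillates G k t) : ∃ t' > t, ∀ s ∈ Set.Ioo t t', StrictlyOscillates G k s := by
  obtain ⟨x, y, hx, hy⟩ := h
  have hev : ∀ᶠ s in nhdsWithin t (Set.Ioi t), ∀ i ∈ Set.Iio k, s < G (y i) :=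
    ((Set.finite_Iio k).eventually_all).2 fun i hi =>
      nhdsWithin_le_nhds (Iio_mem_nhds (hy i hi).2.2)
  obtain ⟨t', ht', hsub⟩ := mem_nhdsGT_iff_exists_Ioo_subset.1 hev
  exact ⟨t', ht', fun s hs => ⟨x, y, fun i hi => ⟨(hx i hi).1, (hx i hi).2.trans_lt hs.1⟩,
    fun i hi => ⟨(hy i hi).1, (hy i hi).2.1, hsub hs i hi⟩⟩⟩

/-- If every point of `S` is the left endpoint of an interval inside `U`, then `S` is contained in
`U` up to countably many points. -/
theorem countable_diff_of_forall_exists_Ioo_subset {S U : Set ℝ}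
    (h : ∀ t ∈ S, ∃ t' > t, Set.Ioo t t' ⊆ U) : (S \ U).Countable := by
  choose! r hr hU using h
  refine Set.PairwiseDisjoint.countable_of_Ioo (y := r) ?_ fun t ht => hr t ht.1
  have key : ∀ s ∈ S \ U, ∀ t ∈ S \ U, s < t → Disjoint (Set.Ioo s (r s)) (Set.Ioo t (r t)) := by
    intro s hs t ht hst
    rw [Set.disjoint_left]
    intro z hz hz'
    exact ht.2 (hU s hs.1 ⟨hst, hz'.1.trans hz.2⟩)
  intro s hs t ht hst
  rcases lt_or_gt_of_ne hst with h | h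
  · exact key s hs t ht h
  · exact (key t ht s hs h).symm

/-- Oscillation across `t` can be made strict except for countably many `t`. -/
theorem ae_oscillates_iff_strictlyOscillates (G : ℝ → ℝ) :
    ∀ᵐ t : ℝ, ∀ k, Oscillates G k t ↔ StrictlyOscillates G k t := by
  rw [MeasureTheory.ae_all_iff]
  intro k
  have hc : ({t | Oscillates G k t} \ {t | StrictlyOscillates G k t}).Countable :=
    countable_diff_of_forall_exists_Ioo_subset fun t ht => ht.exists_Ioo_strictlyOscillates
  filter_upwards [hc.ae_notMem MeasureTheory.volume] with t ht
  refine ⟨fun h => ?_, StrictlyOscillates.oscillates⟩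
  by_contra hn
  exact ht ⟨h, hn⟩

theorem nullMeasurableSet_setOf_oscillates (G : ℝ → ℝ) (k : ℕ) :
    MeasureTheory.NullMeasurableSet {t | Oscillates G k t} := by
  refine (isOpen_setOf_strictlyOscillates G k).measurableSet.nullMeasurableSet.congr ?_
  filter_upwards [ae_oscillates_iff_strictlyOscillates G] with t ht
  exact propext (ht k).symm

/-! ### Downward crossings along grids -/

/-- The number of downward crossings of `t` by the finite sequence `G (0 / n), …, G (n / n)`. -/
noncomputable def gridDowncrossings (G : ℝ → ℝ) (n : ℕ) (t : ℝ) : ENNReal :=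
  ∑ i ∈ Finset.range n,
    (Set.Ico (G ((i + 1 : ℕ) / (n : ℝ))) (G (i / (n : ℝ)))).indicator 1 t

open Classical in
/-- If a finite sequence alternates between values `≤ t` (at the indices `I i`) and values `> t` (at
the indices `J i`), then each return below `t` needs a separate downward crossing; the first visit
needs one unless the sequence starts below `t`. -/
theorem card_le_downcrossings (a : ℕ → ℝ) (t : ℝ) {k n : ℕ} {I J : ℕ → ℕ}
    (hI : ∀ i ≤ k, I i ≤ n ∧ a (I i) ≤ t) (hJ : ∀ i < k, I i ≤ J i ∧ J i ≤ I (i + 1) ∧ t < a (J i)) :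
    ((k + 1 : ℕ) : ENNReal) ≤ (if a 0 ≤ t then 1 else 0) +
      ∑ i ∈ Finset.range n, (Set.Ico (a (i + 1)) (a i)).indicator 1 t := by
  set f : ℕ → ENNReal := fun m => (if a 0 ≤ t then 1 else 0) +
      ∑ i ∈ Finset.range m, (Set.Ico (a (i + 1)) (a i)).indicator 1 t with hf
  have hsucc (m : ℕ) : f (m + 1) = f m + (Set.Ico (a (m + 1)) (a m)).indicator 1 t := by
    simp only [hf, Finset.sum_range_succ, add_assoc]
  have hmono : Monotone f := monotone_nat_of_le_succ fun m => by
    rw [hsucc]; exact le_self_add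
  have hstart : ∀ m, a m ≤ t → 1 ≤ f m := by
    intro m
    induction m with
    | zero => intro h; simp [hf, h]
    | succ m ih =>
      intro h
      rcases le_or_gt (a m) t with hm | hm
      · exact (ih hm).trans (hmono m.le_succ)
      · rw [hsucc, Set.indicator_of_mem (show t ∈ Set.Ico (a (m + 1)) (a m) from ⟨h, hm⟩)]
        exact le_add_self
  have hstep : ∀ j, t < a j → ∀ m, j ≤ m → a m ≤ t → f j + 1 ≤ f m := by
    intro j hj m hjm
    induction m, hjm using Nat.le_induction with
    | base => intro h; linarith
    | succ m hjm ih =>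
      intro h
      rcases le_or_gt (a m) t with hm | hm
      · exact (ih hm).trans (hmono m.le_succ)
      · rw [hsucc, Set.indicator_of_mem (show t ∈ Set.Ico (a (m + 1)) (a m) from ⟨h, hm⟩)]
        exact add_le_add_left (hmono hjm) _
  have hchain : ∀ m ≤ k, ((m + 1 : ℕ) : ENNReal) ≤ f (I m) := by
    intro m
    induction m with
    | zero => intro h; simpa using hstart _ (hI 0 h).2
    | succ m ih =>
      intro h
      obtain ⟨h1, h2, h3⟩ := hJ m h
      rw [Nat.cast_succ]
      calc ((m + 1 : ℕ) : ENNReal) + 1 ≤ f (J m) + 1 :=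
            add_le_add_left ((ih (by omega)).trans (hmono h1)) _
        _ ≤ f (I (m + 1)) := hstep _ h3 _ h2 (hI _ h).2
  exact (hchain k le_rfl).trans (hmono (hI k le_rfl).1)

open Classical in
/-- A strict oscillation is seen by all sufficiently fine grids: replace its points by
the nearest grid points to the left. -/
theorem StrictlyOscillates.eventually_le_gridDowncrossings {G : ℝ → ℝ} (hG : Continuous G) {k : ℕ}
    {t : ℝ} (h : StrictlyOscillates G k t) :
    ∀ᶠ n in Filter.atTop,
      ((k + 1 : ℕ) : ENNReal) ≤ (if G 0 ≤ t then 1 else 0) + gridDowncrossings G n t := by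
  obtain ⟨x, y, hx, hy⟩ := h
  have hlim (z : ℝ) (hz : 0 ≤ z) :
      Filter.Tendsto (fun n : ℕ => G (⌊z * n⌋₊ / (n : ℝ))) Filter.atTop (nhds (G z)) :=
    (hG.tendsto z).comp
      ((tendsto_nat_floor_mul_div_atTop hz).comp tendsto_natCast_atTop_atTop)
  have h1 : ∀ᶠ n : ℕ in Filter.atTop, ∀ i ∈ Set.Iic k, G (⌊x i * n⌋₊ / (n : ℝ)) < t :=
    ((Set.finite_Iic k).eventually_all).2 fun i hi =>
      (hlim _ (hx i hi).1.1).eventually_lt_const (hx i hi).2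
  have h2 : ∀ᶠ n : ℕ in Filter.atTop, ∀ i ∈ Set.Iio k, t < G (⌊y i * n⌋₊ / (n : ℝ)) :=
    ((Set.finite_Iio k).eventually_all).2 fun i hi =>
      (hlim _ ((hx i (le_of_lt hi)).1.1.trans (hy i hi).1.le)).eventually_const_lt (hy i hi).2.2
  filter_upwards [h1, h2] with n hn1 hn2
  have hfl {z w : ℝ} (hzw : z ≤ w) : ⌊z * n⌋₊ ≤ ⌊w * n⌋₊ :=
    Nat.floor_le_floor (mul_le_mul_of_nonneg_right hzw n.cast_nonneg)
  have := card_le_downcrossings (fun i => G (i / (n : ℝ))) t (k := k) (n := n)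
    (I := fun i => ⌊x i * n⌋₊) (J := fun i => ⌊y i * n⌋₊)
    (fun i hi => ⟨by simpa using hfl (hx i hi).1.2, (hn1 i hi).le⟩)
    (fun i hi => ⟨hfl (hy i hi).1.le, hfl (hy i hi).2.1.le, hn2 i hi⟩)
  simpa [gridDowncrossings] using this

theorem lintegral_gridDowncrossings (G : ℝ → ℝ) (n : ℕ) :
    ∫⁻ t, gridDowncrossings G n t =
      ∑ i ∈ Finset.range n, ENNReal.ofReal (G (i / (n : ℝ)) - G ((i + 1 : ℕ) / (n : ℝ))) := by
  simp only [gridDowncrossings]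
  rw [MeasureTheory.lintegral_finsetSum _
    fun i _ => measurable_one.indicator measurableSet_Ico]
  refine Finset.sum_congr rfl fun i _ => ?_
  rw [MeasureTheory.lintegral_indicator_one measurableSet_Ico, Real.volume_Ico]

theorem measurable_gridDowncrossings (G : ℝ → ℝ) (n : ℕ) : Measurable (gridDowncrossings G n) :=
  Finset.measurable_fun_sum _ fun _ _ => measurable_one.indicator measurableSet_Ico

/-- The number of downward crossings of `t` by `G` on `[0, 1]`, as a limit along uniform grids. -/
noncomputable def downcrossings (G : ℝ → ℝ) (t : ℝ) : ENNReal :=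
  Filter.liminf (fun n => gridDowncrossings G n t) Filter.atTop

theorem measurable_downcrossings (G : ℝ → ℝ) : Measurable (downcrossings G) :=
  Measurable.liminf fun n => measurable_gridDowncrossings G n

/-- Fatou's lemma bounds the integral of the number of downward crossings by the negative
variations of `G` along uniform grids. -/
theorem lintegral_downcrossings_le {G : ℝ → ℝ} {C : ENNReal}
    (h : ∀ n ≠ 0, ∑ i ∈ Finset.range n,
      ENNReal.ofReal (G (i / (n : ℝ)) - G ((i + 1 : ℕ) / (n : ℝ))) ≤ C) :
    ∫⁻ t, downcrossings G t ≤ C := by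
  refine (MeasureTheory.lintegral_liminf_le (measurable_gridDowncrossings G)).trans ?_
  refine Filter.liminf_le_of_le (by isBoundedDefault) fun b hb => ?_
  obtain ⟨n, hn, hn0⟩ := (hb.and (Filter.eventually_ne_atTop 0)).exists
  exact hn.trans ((lintegral_gridDowncrossings G n).trans_le (h n hn0))

open Classical in
/-- Walking along `[0, 1]`, every new component of `{G ≤ t}` is entered by a downward crossing,
except for one containing `0`. -/
theorem ae_card_le_downcrossings {G : ℝ → ℝ} (hG : Continuous G) :
    ∀ᵐ t : ℝ, ∀ k : ℕ, (k : ℕ∞) ≤ ENat.card (ConnectedComponents (unitSublevel G t)) →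
      (k : ENNReal) ≤ (if G 0 ≤ t then 1 else 0) + downcrossings G t := by
  filter_upwards [ae_oscillates_iff_strictlyOscillates G] with t ht
  rintro (_ | k) hk
  · simp
  have hs : StrictlyOscillates G k t := (ht k).1 (oscillates_of_le_card hk)
  exact (Filter.le_liminf_of_le (by isBoundedDefault)
    (hs.eventually_le_gridDowncrossings hG)).trans_eq
      (liminf_const_add _ _ _ (by isBoundedDefault) (by isBoundedDefault))

/-- Measurability of the component count: its superlevel sets are open up to null sets. -/
theorem aemeasurable_natCard_connectedComponents (G : ℝ → ℝ)
    (hfin : ∀ᵐ t : ℝ, Finite (ConnectedComponents (unitSublevel G t))) :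
    AEMeasurable (fun t => Nat.card (ConnectedComponents (unitSublevel G t))) := by
  have hle (k : ℕ) : MeasureTheory.NullMeasurableSet
      {t | k ≤ Nat.card (ConnectedComponents (unitSublevel G t))} := by
    rcases k with _ | k
    · simp
    refine (nullMeasurableSet_setOf_oscillates G k).congr ?_
    filter_upwards [hfin] with t ht
    refine propext (oscillates_iff_le_card.trans ?_)
    rw [ENat.card_eq_coe_natCard, Nat.cast_le]
    rfl
  refine MeasureTheory.NullMeasurable.aemeasurable fun s _ => ?_
  rw [← Set.biUnion_preimage_singleton]
  refine MeasureTheory.NullMeasurableSet.biUnion s.to_countable fun k _ => ?_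
  have hk : (fun t => Nat.card (ConnectedComponents (unitSublevel G t))) ⁻¹' {k} =
      {t | k ≤ Nat.card (ConnectedComponents (unitSublevel G t))} \
        {t | k + 1 ≤ Nat.card (ConnectedComponents (unitSublevel G t))} := by
    ext t
    simp only [Set.mem_preimage, Set.mem_singleton_iff, Set.mem_sdiff, Set.mem_ofPred_eq]
    omega
  rw [hk]
  exact (hle k).diff (hle (k + 1))

/-! ### Comparison of component counts -/

/-- The number of components of `{G ≤ t}` is almost everywhere finite, since the number of downward
crossings is integrable. -/
theorem ae_finite_connectedComponents {G : ℝ → ℝ} (hG : Continuous G)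
    (hint : ∫⁻ t, downcrossings G t ≠ ⊤) :
    ∀ᵐ t : ℝ, Finite (ConnectedComponents (unitSublevel G t)) := by
  filter_upwards [ae_card_le_downcrossings hG,
    MeasureTheory.ae_lt_top (measurable_downcrossings G) hint] with t ht htop
  by_contra hinf
  rw [not_finite_iff_infinite] at hinf
  obtain ⟨k, hk⟩ := ENNReal.exists_nat_gt
    (ENNReal.add_lt_top.2 ⟨ENNReal.one_lt_top, htop⟩).ne
  refine absurd ((ht k (by simp [ENat.card_eq_top_of_infinite])).trans ?_) (not_le.2 hk)
  gcongr
  split_ifs <;> simp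

open Classical in
/-- If `G 1 ≤ t < G 0`, then `{G ≤ t}` does not contain `0`, but one downward crossing is forced by
the endpoint values. -/
theorem ae_natCard_add_le_downcrossings {G : ℝ → ℝ} (hG : Continuous G)
    (hfin : ∀ᵐ t : ℝ, Finite (ConnectedComponents (unitSublevel G t))) :
    ∀ᵐ t : ℝ, (Nat.card (ConnectedComponents (unitSublevel G t)) : ENNReal) +
        (if t ∈ Set.Ico (G 1) (G 0) then 1 else 0 : ℕ) ≤
      (if min (G 0) (G 1) ≤ t then 1 else 0 : ℕ) + downcrossings G t := by
  filter_upwards [ae_card_le_downcrossings hG, hfin] with t ht hft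
  have h := ht (Nat.card (ConnectedComponents (unitSublevel G t)))
    (ENat.card_eq_coe_natCard _).ge
  have hcount : (if G 0 ≤ t then 1 else 0 : ENNReal) +
      (if t ∈ Set.Ico (G 1) (G 0) then 1 else 0 : ℕ) =
      (if min (G 0) (G 1) ≤ t then 1 else 0 : ℕ) := by
    simp only [Set.mem_Ico, min_le_iff]
    by_cases h0 : G 0 ≤ t
    · simp [h0, not_lt.2 h0]
    · simp [h0, not_le.1 h0]
  calc _ ≤ _ := add_le_add_left h _
    _ = _ := by rw [add_right_comm, hcount]

theorem one_le_natCard_connectedComponents {G : ℝ → ℝ} {t : ℝ}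
    [Finite (ConnectedComponents (unitSublevel G t))] (h : min (G 0) (G 1) ≤ t) :
    1 ≤ Nat.card (ConnectedComponents (unitSublevel G t)) := by
  have : Nonempty (unitSublevel G t) := by
    rcases min_le_iff.1 h with h | h
    · exact ⟨0, ⟨le_rfl, zero_le_one⟩, h⟩
    · exact ⟨1, ⟨zero_le_one, le_rfl⟩, h⟩
  exact Nat.card_pos

/-- The pointwise estimate behind the comparison of two component counts `c` and `c'`: `m` is the
Heaviside term, `i` indicates a forced downward crossing and `D` counts all downward crossings. -/
theorem ofReal_abs_sub_add_le {c c' i i' m m' : ℕ} {D D' : ENNReal}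
    (h : (c : ENNReal) + i ≤ m + D) (h' : (c' : ENNReal) + i' ≤ m' + D') (hm : m ≤ c)
    (hm' : m' ≤ c') :
    ENNReal.ofReal |(c : ℝ) - c'| + i + i' ≤ ENNReal.ofReal |(m : ℝ) - m'| + (D + D') := by
  rcases eq_or_ne D ⊤ with rfl | hD
  · simp
  rcases eq_or_ne D' ⊤ with rfl | hD'
  · simp
  have hr := ENNReal.toReal_mono (by finiteness) h
  have hr' := ENNReal.toReal_mono (by finiteness) h'
  rw [← ENNReal.toReal_le_toReal (by finiteness) (by finiteness)]
  rw [ENNReal.toReal_add (by finiteness) (by finiteness),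
    ENNReal.toReal_add (by finiteness) (by finiteness)] at hr hr' ⊢
  rw [ENNReal.toReal_add (by finiteness) (by finiteness),
    ENNReal.toReal_add (by finiteness) (by finiteness)]
  simp only [ENNReal.toReal_natCast, ENNReal.toReal_ofReal (abs_nonneg _)] at hr hr' ⊢
  have hmr : (m : ℝ) ≤ c := by exact_mod_cast hm
  have hmr' : (m' : ℝ) ≤ c' := by exact_mod_cast hm'
  have := neg_abs_le ((m : ℝ) - m')
  have := le_abs_self ((m : ℝ) - m')
  rcases abs_cases ((c : ℝ) - c') with ⟨hc, -⟩ | ⟨hc, -⟩ <;> rw [hc] <;> linarith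

open Classical in
theorem lintegral_ofReal_abs_heaviside_sub (a b : ℝ) :
    ∫⁻ t, ENNReal.ofReal |((if a ≤ t then 1 else 0 : ℕ) : ℝ) - (if b ≤ t then 1 else 0 : ℕ)| =
      ENNReal.ofReal |a - b| := by
  rw [← max_sub_min_eq_abs', ← Real.volume_Ico,
    ← MeasureTheory.lintegral_indicator_one measurableSet_Ico]
  refine MeasureTheory.lintegral_congr fun t => ?_
  by_cases ha : a ≤ t <;> by_cases hb : b ≤ t <;>
    simp [ha, hb, not_lt.2, not_le.1]

/-- Both component counts differ from the Heaviside functions of the smaller endpoint values by at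
most the numbers of downward crossings that the endpoint values do not force. -/
theorem lintegral_natCard_sub_natCard_le {G H : ℝ → ℝ} (hG : Continuous G) (hH : Continuous H)
    {s s' : ℝ}
    (hGs : ∫⁻ t, downcrossings G t ≤ ENNReal.ofReal (G 0 - G 1) + ENNReal.ofReal s)
    (hHs : ∫⁻ t, downcrossings H t ≤ ENNReal.ofReal (H 0 - H 1) + ENNReal.ofReal s') :
    ∫⁻ t, ENNReal.ofReal |(Nat.card (ConnectedComponents (unitSublevel G t)) : ℝ) -
        Nat.card (ConnectedComponents (unitSublevel H t))| ≤
      ENNReal.ofReal |min (G 0) (G 1) - min (H 0) (H 1)| +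
        (ENNReal.ofReal s + ENNReal.ofReal s') := by
  classical
  have hGf := ae_finite_connectedComponents hG (ne_top_of_le_ne_top (by finiteness) hGs)
  have hHf := ae_finite_connectedComponents hH (ne_top_of_le_ne_top (by finiteness) hHs)
  have hforced (a b : ℝ) : Measurable
      fun t : ℝ => (((if t ∈ Set.Ico a b then 1 else 0 : ℕ) : ℕ) : ENNReal) :=
    measurable_from_top.comp (Measurable.ite measurableSet_Ico measurable_const measurable_const)
  have hforced_int (a b : ℝ) :
      ∫⁻ t : ℝ, (((if t ∈ Set.Ico a b then 1 else 0 : ℕ) : ℕ) : ENNReal) =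
        ENNReal.ofReal (b - a) := by
    rw [← Real.volume_Ico, ← MeasureTheory.lintegral_indicator_one measurableSet_Ico]
    refine MeasureTheory.lintegral_congr fun t => ?_
    by_cases h : t ∈ Set.Ico a b <;> simp [h]
  have hD : Measurable fun t => downcrossings G t + downcrossings H t :=
    (measurable_downcrossings G).add (measurable_downcrossings H)
  have hpt := MeasureTheory.lintegral_mono_ae (μ := MeasureTheory.volume) <| by
    filter_upwards [ae_natCard_add_le_downcrossings hG hGf,
      ae_natCard_add_le_downcrossings hH hHf, hGf, hHf] with t hGt hHt hGft hHft
    refine ofReal_abs_sub_add_le hGt hHt ?_ ?_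
    · split_ifs with h
      · exact one_le_natCard_connectedComponents h
      · exact Nat.zero_le _
    · split_ifs with h
      · exact one_le_natCard_connectedComponents h
      · exact Nat.zero_le _
  rw [MeasureTheory.lintegral_add_right _ (hforced _ _),
    MeasureTheory.lintegral_add_right _ (hforced _ _), hforced_int, hforced_int,
    MeasureTheory.lintegral_add_right _ hD,
    MeasureTheory.lintegral_add_right _ (measurable_downcrossings H),
    lintegral_ofReal_abs_heaviside_sub] at hpt
  -- The forced crossings contribute finitely on both sides and cancel.
  have hfin : ENNReal.ofReal (G 0 - G 1) + ENNReal.ofReal (H 0 - H 1) ≠ ⊤ := by finiteness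
  rw [← ENNReal.add_le_add_iff_right hfin, ← add_assoc]
  refine (hpt.trans (add_le_add_right (add_le_add hGs hHs) _)).trans_eq ?_
  ring

/-! ### Backward displacement of polygons -/

/-- Reflecting the steps of a polygon that point away from `v` in the hyperplane orthogonal to `v`
preserves its length and moves its endpoint by twice the total backward displacement. -/
theorem norm_add_backward_smul_le {E : Type*} [NormedAddCommGroup E] [InnerProductSpace ℝ E]
    (P : ℕ → E) (n : ℕ) (v : E) (hv : ‖v‖ = 1) :
    ‖P n - P 0 + (2 * ∑ i ∈ Finset.range n, max (inner ℝ (P i - P (i + 1)) v) 0) • v‖ ≤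
      ∑ i ∈ Finset.range n, ‖P (i + 1) - P i‖ := by
  have hstep (i : ℕ) : ‖P (i + 1) - P i + (2 * max (inner ℝ (P i - P (i + 1)) v) 0) • v‖ =
      ‖P (i + 1) - P i‖ := by
    rw [← sq_eq_sq₀ (norm_nonneg _) (norm_nonneg _), norm_add_sq_real, inner_smul_right,
      norm_smul, hv, mul_one, Real.norm_eq_abs, sq_abs,
      show P i - P (i + 1) = -(P (i + 1) - P i) by abel, inner_neg_left]
    rcases le_total (-(inner ℝ (P (i + 1) - P i) v)) 0 with h | h
    · rw [max_eq_right h]; ring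
    · rw [max_eq_left h]; ring
  rw [Finset.mul_sum, Finset.sum_smul, ← Finset.sum_range_sub, ← Finset.sum_add_distrib]
  exact (norm_sum_le _ _).trans_eq (Finset.sum_congr rfl fun i _ => hstep i)

/-- The backward displacement of a polygon in a direction `v` exceeds the one forced by its
endpoints by at most half of `√(ℓ² - D²)`, where `ℓ` bounds its length and `D` is the distance of
its endpoints. -/
theorem sum_backward_le {E : Type*} [NormedAddCommGroup E] [InnerProductSpace ℝ E]
    (P : ℕ → E) (n : ℕ) (v : E) (hv : ‖v‖ = 1) {ℓ : ℝ}
    (hℓ : ∑ i ∈ Finset.range n, ‖P (i + 1) - P i‖ ≤ ℓ) :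
    ∑ i ∈ Finset.range n, max (inner ℝ (P i - P (i + 1)) v) 0 ≤
      max (inner ℝ (P 0 - P n) v) 0 + √(ℓ ^ 2 - ‖P n - P 0‖ ^ 2) / 2 := by
  have hB := (norm_add_backward_smul_le P n v hv).trans hℓ
  have hF := (norm_add_backward_smul_le P n (-v) (by rwa [norm_neg])).trans hℓ
  set B := ∑ i ∈ Finset.range n, max (inner ℝ (P i - P (i + 1)) v) 0 with hBdef
  set F := ∑ i ∈ Finset.range n, max (inner ℝ (P i - P (i + 1)) (-v)) 0 with hFdef
  have hB0 : 0 ≤ B := Finset.sum_nonneg fun i _ => le_max_right _ _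
  have hF0 : 0 ≤ F := Finset.sum_nonneg fun i _ => le_max_right _ _
  have hBF : B - F = inner ℝ (P 0 - P n) v := by
    rw [hBdef, hFdef, ← Finset.sum_sub_distrib, ← Finset.sum_range_sub', sum_inner]
    refine Finset.sum_congr rfl fun i _ => ?_
    rw [inner_neg_right]
    rcases le_total (inner ℝ (P i - P (i + 1)) v) 0 with h | h
    · rw [max_eq_right h, max_eq_left (by linarith)]; ring
    · rw [max_eq_left h, max_eq_right (by linarith)]; ring
  have hinner : inner ℝ (P n - P 0) v = F - B := by
    rw [show P n - P 0 = -(P 0 - P n) by abel, inner_neg_left, ← hBF]; ring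
  have hB2 := pow_le_pow_left₀ (norm_nonneg _) hB 2
  have hF2 := pow_le_pow_left₀ (norm_nonneg _) hF 2
  rw [norm_add_sq_real, inner_smul_right, norm_smul, hv, mul_one, Real.norm_eq_abs, sq_abs,
    hinner] at hB2
  rw [norm_add_sq_real, inner_smul_right, norm_smul, norm_neg, hv, mul_one, Real.norm_eq_abs,
    sq_abs, inner_neg_right, hinner] at hF2
  rw [← hBF]
  rcases le_total B F with h | h
  · have : 2 * B ≤ √(ℓ ^ 2 - ‖P n - P 0‖ ^ 2) := Real.le_sqrt_of_sq_le (by nlinarith)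
    linarith [le_max_right (B - F) 0]
  · have : 2 * F ≤ √(ℓ ^ 2 - ‖P n - P 0‖ ^ 2) := Real.le_sqrt_of_sq_le (by nlinarith)
    linarith [le_max_left (B - F) 0]

/-! ### Height functions and the Euler characteristic transform -/

/-- The height function of a path in the direction `v`, extended to a function on the line which is
constant on both sides of the unit interval. -/
noncomputable def heightFunction {d : ℕ} (γ : unitInterval → EuclideanSpace ℝ (Fin d))
    (v : EuclideanSpace ℝ (Fin d)) (x : ℝ) : ℝ :=
  inner ℝ (Set.IccExtend (zero_le_one' ℝ) γ x) v

theorem continuous_heightFunction {d : ℕ} {γ : unitInterval → EuclideanSpace ℝ (Fin d)}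
    (hγ : Continuous γ) (v : EuclideanSpace ℝ (Fin d)) : Continuous (heightFunction γ v) :=
  hγ.Icc_extend'.inner continuous_const

theorem heightFunction_coe {d : ℕ} (γ : unitInterval → EuclideanSpace ℝ (Fin d))
    (v : EuclideanSpace ℝ (Fin d)) (x : unitInterval) :
    heightFunction γ v x = inner ℝ (γ x) v := by
  rw [heightFunction, Set.IccExtend_val]

/-- The sublevel set defining the Euler characteristic transform, as a subset of the line. -/
def sublevelHomeomorph {d : ℕ} (γ : unitInterval → EuclideanSpace ℝ (Fin d))
    (v : EuclideanSpace ℝ (Fin d)) (t : ℝ) :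
    {z : unitInterval // inner ℝ (γ z) v ≤ t} ≃ₜ unitSublevel (heightFunction γ v) t where
  toFun z := ⟨z.1, z.1.2, by rw [heightFunction_coe]; exact z.2⟩
  invFun x := ⟨⟨x, x.2.1⟩, by rw [← heightFunction_coe]; exact x.2.2⟩
  left_inv _ := rfl
  right_inv _ := rfl
  continuous_toFun := by fun_prop
  continuous_invFun := by fun_prop

theorem ect_eq_natCard {d : ℕ} (γ : unitInterval → EuclideanSpace ℝ (Fin d))
    (v : Metric.sphere (0 : EuclideanSpace ℝ (Fin d)) 1) (t : ℝ)
    [Finite (ConnectedComponents (unitSublevel (heightFunction γ v) t))] :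
    ect γ v t =
      ((Nat.card (ConnectedComponents (unitSublevel (heightFunction γ v) t)) : ℤ) : WithTop ℤ) :=
  eulerCharacteristic_eq_natCard_of_homotopyEquiv
    ((sublevelHomeomorph γ v t).toHomotopyEquiv.trans (homotopyEquivConnectedComponents _))

theorem extAbs_ect_sub_ect {d : ℕ} (α β : unitInterval → EuclideanSpace ℝ (Fin d))
    (v : Metric.sphere (0 : EuclideanSpace ℝ (Fin d)) 1) (t : ℝ)
    [Finite (ConnectedComponents (unitSublevel (heightFunction α v) t))]
    [Finite (ConnectedComponents (unitSublevel (heightFunction β v) t))] :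
    extAbs ((ect α - ect β) v t) =
      ENNReal.ofReal |(Nat.card (ConnectedComponents (unitSublevel (heightFunction α v) t)) : ℝ) -
        Nat.card (ConnectedComponents (unitSublevel (heightFunction β v) t))| := by
  rw [Pi.sub_apply, Pi.sub_apply, ect_eq_natCard, ect_eq_natCard]
  -- The difference of two finite values of `WithTop ℤ` is definitionally the integer difference.
  change ENNReal.ofReal |(((_ : ℤ) - (_ : ℤ) : ℤ) : ℝ)| = _
  simp

/-- A path of length at most `ℓ` has, in every direction, at most `√(ℓ² - D²) / 2` more downward
crossings than its endpoints force, where `D` is the distance of its endpoints. -/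
theorem lintegral_downcrossings_heightFunction_le {d : ℕ}
    {γ : unitInterval → EuclideanSpace ℝ (Fin d)} {ℓ : ℝ} (hℓ : 0 ≤ ℓ)
    (hlen : arcLength γ ≤ ENNReal.ofReal ℓ) {v : EuclideanSpace ℝ (Fin d)} (hv : ‖v‖ = 1) :
    ∫⁻ t, downcrossings (heightFunction γ v) t ≤
      ENNReal.ofReal (heightFunction γ v 0 - heightFunction γ v 1) +
        ENNReal.ofReal (√(ℓ ^ 2 - dist (γ 0) (γ 1) ^ 2) / 2) := by
  refine lintegral_downcrossings_le fun n hn => ?_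
  set P : ℕ → EuclideanSpace ℝ (Fin d) :=
    fun i => Set.IccExtend (zero_le_one' ℝ) γ (i / (n : ℝ)) with hP
  have hn' : (n : ℝ) ≠ 0 := Nat.cast_ne_zero.2 hn
  have hP0 : P 0 = γ 0 := by simp [hP, Set.IccExtend_left]
  have hPn : P n = γ 1 := by simp [hP, hn', Set.IccExtend_right]
  have hmono : Monotone fun i : ℕ => Set.projIcc (0 : ℝ) 1 zero_le_one (i / (n : ℝ)) :=
    fun i j hij => Set.monotone_projIcc _ (by gcongr)
  have hvar : ∑ i ∈ Finset.range n, ‖P (i + 1) - P i‖ ≤ ℓ := by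
    have h := (eVariationOn.sum_le (f := γ) (s := Set.univ) (n := n) hmono
      fun _ => Set.mem_univ _).trans hlen
    simp only [edist_dist] at h
    rw [← ENNReal.ofReal_sum_of_nonneg fun _ _ => dist_nonneg, ENNReal.ofReal_le_ofReal_iff hℓ] at h
    exact (Finset.sum_congr rfl fun i _ => (dist_eq_norm _ _).symm).trans_le h
  have hb := sum_backward_le P n v hv hvar
  have hterm (i : ℕ) : ENNReal.ofReal (heightFunction γ v (i / (n : ℝ)) -
      heightFunction γ v ((i + 1 : ℕ) / (n : ℝ))) =
      ENNReal.ofReal (max (inner ℝ (P i - P (i + 1)) v) 0) := by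
    rw [inner_sub_left, ENNReal.ofReal_max, ENNReal.ofReal_zero, max_eq_left zero_le]
    rfl
  have hend : heightFunction γ v 0 - heightFunction γ v 1 = inner ℝ (P 0 - P n) v := by
    rw [hP0, hPn, inner_sub_left, ← heightFunction_coe γ v 0, ← heightFunction_coe γ v 1]
    rfl
  simp only [hterm]
  rw [← ENNReal.ofReal_sum_of_nonneg fun _ _ => le_max_right _ _, hend]
  refine (ENNReal.ofReal_le_ofReal hb).trans (ENNReal.ofReal_add_le.trans ?_)
  rw [ENNReal.ofReal_max, ENNReal.ofReal_zero, max_eq_left zero_le, dist_eq_norm, norm_sub_rev,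
    hP0, hPn]

/-- For a path of finite length, the Euler characteristic of almost every sublevel set in a given
direction is a finite number of components. -/
theorem ae_finite_connectedComponents_heightFunction {d : ℕ}
    {γ : unitInterval → EuclideanSpace ℝ (Fin d)} (hγ : Continuous γ) {ℓ : ℝ} (hℓ : 0 ≤ ℓ)
    (hlen : arcLength γ ≤ ENNReal.ofReal ℓ) {v : EuclideanSpace ℝ (Fin d)} (hv : ‖v‖ = 1) :
    ∀ᵐ t : ℝ, Finite (ConnectedComponents (unitSublevel (heightFunction γ v) t)) :=
  ae_finite_connectedComponents (continuous_heightFunction hγ v)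
    (ne_top_of_le_ne_top (by finiteness)
      (lintegral_downcrossings_heightFunction_le hℓ hlen hv))

theorem aemeasurable_extAbs_ect_sub_ect {d : ℕ} {α β : unitInterval → EuclideanSpace ℝ (Fin d)}
    (hα : Continuous α) (hβ : Continuous β) {ℓ ℓ' : ℝ} (hℓ : 0 ≤ ℓ) (hℓ' : 0 ≤ ℓ')
    (hαlen : arcLength α ≤ ENNReal.ofReal ℓ) (hβlen : arcLength β ≤ ENNReal.ofReal ℓ')
    (v : Metric.sphere (0 : EuclideanSpace ℝ (Fin d)) 1) :
    AEMeasurable (fun t => extAbs ((ect α - ect β) v t)) := by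
  have hv := norm_eq_of_mem_sphere v
  have hαf := ae_finite_connectedComponents_heightFunction hα hℓ hαlen hv
  have hβf := ae_finite_connectedComponents_heightFunction hβ hℓ' hβlen hv
  have hm := (aemeasurable_natCard_connectedComponents _ hαf).prodMk
    (aemeasurable_natCard_connectedComponents _ hβf)
  have hmeas : Measurable fun p : ℕ × ℕ => ENNReal.ofReal |(p.1 : ℝ) - p.2| := .of_discrete
  refine (hmeas.comp_aemeasurable hm).congr ?_
  filter_upwards [hαf, hβf] with t _ _
  exact (extAbs_ect_sub_ect α β v t).symm

/-- The distance of the transforms of two paths in one direction, in terms of bounds `ℓ`, `ℓ'` for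
their lengths and of the positions of their endpoints. -/
theorem lintegral_extAbs_ect_sub_ect_le {d : ℕ} {α β : unitInterval → EuclideanSpace ℝ (Fin d)}
    (hα : Continuous α) (hβ : Continuous β) {ℓ ℓ' ε : ℝ} (hℓ : 0 ≤ ℓ) (hℓ' : 0 ≤ ℓ')
    (hαlen : arcLength α ≤ ENNReal.ofReal ℓ) (hβlen : arcLength β ≤ ENNReal.ofReal ℓ')
    (h0 : dist (α 0) (β 0) ≤ ε) (h1 : dist (α 1) (β 1) ≤ ε)
    (v : Metric.sphere (0 : EuclideanSpace ℝ (Fin d)) 1) :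
    ∫⁻ t, extAbs ((ect α - ect β) v t) ≤
      ENNReal.ofReal (ε + (√(ℓ ^ 2 - dist (α 0) (α 1) ^ 2) / 2 +
        √(ℓ' ^ 2 - dist (β 0) (β 1) ^ 2) / 2)) := by
  have hv := norm_eq_of_mem_sphere v
  have hpt (x : unitInterval) (hx : dist (α x) (β x) ≤ ε) :
      |heightFunction α v x - heightFunction β v x| ≤ ε := by
    rw [heightFunction_coe, heightFunction_coe, ← inner_sub_left]
    refine (abs_real_inner_le_norm _ _).trans ?_
    rwa [hv, mul_one, ← dist_eq_norm]
  have hmin : |min (heightFunction α v 0) (heightFunction α v 1) -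
      min (heightFunction β v 0) (heightFunction β v 1)| ≤ ε :=
    (abs_min_sub_min_le_max _ _ _ _).trans (max_le (hpt 0 h0) (hpt 1 h1))
  have hcongr : (fun t => extAbs ((ect α - ect β) v t)) =ᵐ[MeasureTheory.volume] fun t =>
      ENNReal.ofReal |(Nat.card (ConnectedComponents (unitSublevel (heightFunction α v) t)) : ℝ) -
        Nat.card (ConnectedComponents (unitSublevel (heightFunction β v) t))| := by
    filter_upwards [ae_finite_connectedComponents_heightFunction hα hℓ hαlen hv,
      ae_finite_connectedComponents_heightFunction hβ hℓ' hβlen hv] with t _ _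
    exact extAbs_ect_sub_ect α β v t
  rw [MeasureTheory.lintegral_congr_ae hcongr,
    ENNReal.ofReal_add (dist_nonneg.trans h0) (by positivity),
    ENNReal.ofReal_add (by positivity) (by positivity)]
  exact (lintegral_natCard_sub_natCard_le (continuous_heightFunction hα v)
    (continuous_heightFunction hβ v) (lintegral_downcrossings_heightFunction_le hℓ hαlen hv)
    (lintegral_downcrossings_heightFunction_le hℓ' hβlen hv)).trans
      (add_le_add_left (ENNReal.ofReal_le_ofReal hmin) _)

theorem proposition3p6 {d : ℕ} (α β : unitInterval → EuclideanSpace ℝ (Fin d)) (L ε a : ℝ)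
    (hα : IsPiecewiseC1 α) (hβ : IsPiecewiseC1 β)
    (hL : dist (α 0) (α 1) = L)
    (hαlen : arcLength α ≤ ENNReal.ofReal (L + ε))
    (hβlen : arcLength β ≤ ENNReal.ofReal (L + 2 * ε))
    (h0 : dist (α 0) (β 0) ≤ ε) (h1 : dist (α 1) (β 1) ≤ ε)
    (haα : ∀ x, ‖α x‖ ≤ a) (haβ : ∀ x, ‖β x‖ ≤ a) :
    (∀ v, AEMeasurable (fun t => extAbs ((ect α - ect β) v t)) MeasureTheory.volume) ∧
    (2 * ε < L → ectNorm a (ect α - ect β) ≤ ENNReal.ofReal (8 * Real.sqrt (L * ε))) ∧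
    (L ≤ 2 * ε → ectNorm a (ect α - ect β) ≤ ENNReal.ofReal (10 * ε)) := by
  have hL0 : 0 ≤ L := hL ▸ dist_nonneg
  have hε : 0 ≤ ε := dist_nonneg.trans h0
  have hnorm : ectNorm a (ect α - ect β) ≤
      ENNReal.ofReal (ε + (√((L + ε) ^ 2 - L ^ 2) / 2 +
        √((L + 2 * ε) ^ 2 - dist (β 0) (β 1) ^ 2) / 2)) := by
    refine iSup_le fun v => (MeasureTheory.setLIntegral_le_lintegral _ _).trans ?_
    have h := lintegral_extAbs_ect_sub_ect_le hα.1 hβ.1 (by positivity) (by positivity)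
      hαlen hβlen h0 h1 v
    rwa [hL] at h
  refine ⟨aemeasurable_extAbs_ect_sub_ect hα.1 hβ.1 (by positivity) (by positivity) hαlen hβlen,
    fun hLε => ?_, fun hLε => ?_⟩
  · refine hnorm.trans (ENNReal.ofReal_le_ofReal ?_)
    have hdist : L - 2 * ε ≤ dist (β 0) (β 1) := by
      have := dist_triangle4 (α 0) (β 0) (β 1) (α 1)
      rw [dist_comm (β 1)] at this
      linarith
    have hr := Real.sqrt_nonneg (L * ε)
    have hr2 : √(L * ε) ^ 2 = L * ε := Real.sq_sqrt (by positivity)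
    have hεL : ε ^ 2 ≤ L * ε := by nlinarith
    -- `(L + ε)² - L² ≤ 3Lε` and `(L + 2ε)² - (L - 2ε)² = 8Lε`; both are at most `9Lε`.
    have e1 : ε ≤ √(L * ε) := Real.le_sqrt_of_sq_le hεL
    have e2 : √((L + ε) ^ 2 - L ^ 2) ≤ 3 * √(L * ε) :=
      Real.sqrt_le_iff.2 ⟨by positivity, by nlinarith⟩
    have e3 : √((L + 2 * ε) ^ 2 - dist (β 0) (β 1) ^ 2) ≤ 3 * √(L * ε) :=
      Real.sqrt_le_iff.2 ⟨by positivity, by nlinarith⟩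
    linarith
  · refine hnorm.trans (ENNReal.ofReal_le_ofReal ?_)
    have e2 : √((L + ε) ^ 2 - L ^ 2) ≤ L + ε :=
      Real.sqrt_le_iff.2 ⟨by positivity, by nlinarith⟩
    have e3 : √((L + 2 * ε) ^ 2 - dist (β 0) (β 1) ^ 2) ≤ L + 2 * ε :=
      Real.sqrt_le_iff.2 ⟨by positivity, by nlinarith [sq_nonneg (dist (β 0) (β 1))]⟩
    linarith
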